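/- Let $\alpha\in\mathbb{R}$ and let $\mathbb{A}_\alpha$ be the noncommutative torus, i.e. the universal unital $C^*$-algebra generated by two unitaries $U,V$ with $UV=e^{2\pi i\alpha}VU$, with its canonical trace $\tau$, the state determined by $\tau(U^mV^n)=\delta_{m,0}\delta_{n,0}$ for $m,n\in\mathbb{Z}$. For $\theta\in\mathbb{R}$ and a continuous function $f:\mathbb{T}\to\mathbb{T}$ on the unit circle $\mathbb{T}$, let $\Phi_{\theta,f}$ be the Anzai skew-product, i.e. the $*$-automorphism of $\mathbb{A}_\alpha$ determined by $\Phi_{\theta,f}(U)=e^{i\theta}U$ and $\Phi_{\theta,f}(V)=f(U)V$. Suppose that $\theta/2\pi$ is irrational, and let $f(z)=z_oz$ with $z_o\in\mathbb{T}$. Then, for every $\alpha\in\mathbb{R}$, the $C^*$-dynamical system $(\mathbb{A}_\alpha,\Phi_{\theta,f},\tau)$ is ergodic: $\tau$ is $\Phi_{\theta,f}$-invariant; in the GNS representation $(\mathcal{H}_\tau,\pi_\tau,\xi_\tau)$ the vectors fixed by the isometry $V_{\tau,\Phi_{\theta,f}}$, which is given by $V_{\tau,\Phi_{\theta,f}}\pi_\tau(a)\xi_\tau=\pi_\tau(\Phi_{\theta,f}(a))\xi_\tau$,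 are exactly the multiples of $\xi_\tau$; and $\tau$ is an extreme point of the convex set of $\Phi_{\theta,f}$-invariant states. Hence $(\mathbb{A}_\alpha,\Phi_{\theta,f})$ is uniquely ergodic: $\tau$ is its only invariant state. -/

import Mathlib

noncomputable section

namespace CStarDynamics

variable {A B : Type*} [CStarAlgebra A] [CStarAlgebra B]
/-- The homomorphism of unitary groups induced by a unital `*`-homomorphism. -/
def mapUnitary (φ : A →⋆ₐ[ℂ] B) : unitary A →* unitary B where
  toFun u := ⟨φ u, Unitary.map_mem φ u.2⟩
  map_one' := Subtype.ext (map_one φ)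
  map_mul' u v := Subtype.ext (map_mul φ (u : A) (v : A))

theorem circle_star_mul_self (c : Circle) : star (c : ℂ) * (c : ℂ) = 1 := by
  have := Circle.coe_mul c⁻¹ c
  rw [inv_mul_cancel, Circle.coe_one, Circle.coe_inv_eq_conj] at this
  exact this.symm

/-- The unitary `c u`, for `c` on the unit circle and `u` unitary. -/
def scaleUnitary (c : Circle) (u : unitary A) : unitary A :=
  ⟨(c : ℂ) • (u : A), by
    rw [Unitary.mem_iff]
    constructor
    · rw [star_smul, smul_mul_smul_comm, Unitary.star_mul_self_of_mem u.2, circle_star_mul_self, one_smul]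
    · rw [star_smul, smul_mul_smul_comm, Unitary.mul_star_self_of_mem u.2, mul_comm, circle_star_mul_self, one_smul]⟩

/-- The inclusion of the spectrum of a unitary into the unit circle. -/
def spectrumToCircle (u : unitary A) : C(spectrum ℂ (u : A), Circle) where
  toFun z := ⟨z, spectrum.subset_circle_of_unitary u.2 z.2⟩
  continuous_toFun := by
    exact continuous_subtype_val.subtype_mk _

/-- The continuous functional calculus `f ↦ f(u)` of a unitary `u`, for `f ∈ C(𝕋)`. -/
def circleCalculus (u : unitary A) : C(Circle, ℂ) →⋆ₐ[ℂ] A :=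
  (cfcHom (R := ℂ) (p := IsStarNormal) (a := (u : A)) inferInstance).comp
    (ContinuousMap.compStarAlgHom' ℂ ℂ (spectrumToCircle u))

/-- The inclusion of the unit circle in `ℂ`. -/
def circleCoe : C(Circle, ℂ) := ⟨fun z => z, by fun_prop⟩

theorem circleCalculus_coe (u : unitary A) : circleCalculus u circleCoe = u :=
  cfcHom_id (R := ℂ) (p := IsStarNormal) (a := (u : A)) inferInstance

theorem continuous_circleHom (φ : C(Circle, ℂ) →⋆ₐ[ℂ] A) : Continuous φ :=
  AddMonoidHomClass.continuous_of_bound φ 1 fun x => by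
    simpa using NonUnitalStarAlgHom.norm_apply_le φ x

theorem circleHom_ext {φ ψ : C(Circle, ℂ) →⋆ₐ[ℂ] A} (h : φ circleCoe = ψ circleCoe) : φ = ψ := by
  have : CompactSpace (Submonoid.unitSphere ℂ : Set ℂ) := inferInstanceAs (CompactSpace Circle)
  refine ContinuousMap.starAlgHom_ext_map_X (s := (Submonoid.unitSphere ℂ : Set ℂ)) (φ := φ) (ψ := ψ)
    (continuous_circleHom φ) (continuous_circleHom ψ) ?_
  have e : (Polynomial.toContinuousMapOnAlgHom (Submonoid.unitSphere ℂ : Set ℂ) Polynomial.X :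
      C((Submonoid.unitSphere ℂ : Set ℂ), ℂ)) = circleCoe := by
    ext z
    exact (Polynomial.toContinuousMapOn_apply _ _ z).trans Polynomial.eval_X
  exact (congrArg φ e).trans (h.trans (congrArg ψ e).symm)

theorem map_circleCalculus (φ : A →⋆ₐ[ℂ] B) (u : unitary A) (f : C(Circle, ℂ)) :
    φ (circleCalculus u f) = circleCalculus (mapUnitary φ u) f := by
  refine DFunLike.congr_fun (?_ : φ.comp (circleCalculus u) = _) f
  apply circleHom_ext
  simp [circleCalculus_coe, mapUnitary]

/-- The unitary `f(u)` for a unitary `u` and a continuous function `f : 𝕋 → 𝕋`. -/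
def unitaryCalculus (u : unitary A) : C(Circle, Circle) →* unitary A where
  toFun f := ⟨circleCalculus u (circleCoe.comp f), by
    apply Unitary.map_mem
    rw [Unitary.mem_iff]
    constructor <;> ext z
    · exact circle_star_mul_self (f z)
    · exact (mul_comm _ _).trans (circle_star_mul_self (f z)) ⟩
  map_one' := Subtype.ext <| (map_one (circleCalculus u) :)
  map_mul' f g := Subtype.ext <| (map_mul (circleCalculus u) (circleCoe.comp f) (circleCoe.comp g) :)

theorem map_unitaryCalculus (φ : A →⋆ₐ[ℂ] B) (u : unitary A) (f : C(Circle, Circle)) :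
    φ (unitaryCalculus u f) = unitaryCalculus (mapUnitary φ u) f := map_circleCalculus ..

theorem unitaryCalculus_id (u : unitary A) : unitaryCalculus u (.id Circle) = u :=
  Subtype.ext (circleCalculus_coe u)

theorem unitaryCalculus_const_mul (u : unitary A) (c : Circle) (f : C(Circle, Circle)) :
    unitaryCalculus u (f.comp (ContinuousMap.mulLeft c)) = unitaryCalculus (scaleUnitary c u) f := by
  refine Subtype.ext <| DFunLike.congr_fun (?_ : (circleCalculus u).comp (ContinuousMap.compStarAlgHom' ℂ ℂ (ContinuousMap.mulLeft c)) = circleCalculus (scaleUnitary c u)) (circleCoe.comp f)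
  apply circleHom_ext
  rw [circleCalculus_coe]
  have : circleCoe.comp (ContinuousMap.mulLeft c) = (c : ℂ) • circleCoe := by
    ext z
    exact Circle.coe_mul c z
  simp [this, circleCalculus_coe, scaleUnitary]

theorem commute_unitaryCalculus (u : unitary A) (f : C(Circle, Circle)) :
    Commute u (unitaryCalculus u f) := by
  conv => enter [1]; rw [← unitaryCalculus_id u]
  exact (Commute.all _ _).map _

open scoped ComplexOrder

/-- The states of a unital C⋆-algebra: positive functionals `φ` with `φ 1 = 1`. -/
def stateSpace (A : Type*) [CStarAlgebra A] [PartialOrder A] : Set (A →L[ℂ] ℂ) :=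
  {φ | (∀ a, 0 ≤ a → 0 ≤ φ a) ∧ φ 1 = 1}

variable [PartialOrder A]

/-- The states that are invariant under `Φ`. -/
def invariantStates (Φ : A →⋆ₐ[ℂ] A) : Set (A →L[ℂ] ℂ) :=
  {φ | φ ∈ stateSpace A ∧ ∀ a, φ (Φ a) = φ a}

/-- A state as a bundled positive linear map. -/
def toPositive (φ : A →L[ℂ] ℂ) [StarOrderedRing A] (h : φ ∈ stateSpace A) : A →ₚ[ℂ] ℂ :=
  PositiveLinearMap.mk₀ (φ : A →ₗ[ℂ] ℂ) h.1

variable [StarOrderedRing A]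

/-- The isometry `a ↦ Φ a` of the pre-GNS space of a `Φ`-invariant positive functional. -/
def preKoopman (f : A →ₚ[ℂ] ℂ) (Φ : A →⋆ₐ[ℂ] A) (h : ∀ a, f (Φ a) = f a) : f.PreGNS →ₗᵢ[ℂ] f.PreGNS where
  toLinearMap := f.toPreGNS.toLinearMap ∘ₗ (Φ : A →ₗ[ℂ] A) ∘ₗ f.ofPreGNS.toLinearMap
  norm_map' x := by
    simp [PositiveLinearMap.preGNS_norm_def, ← map_star, ← map_mul, h]

/-- The operator `V` on the GNS space of a `Φ`-invariant positive functional which is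
determined by `V π(a) ξ = π(Φ a) ξ`, with `ξ` the cyclic vector. -/
def koopman (f : A →ₚ[ℂ] ℂ) (Φ : A →⋆ₐ[ℂ] A) (h : ∀ a, f (Φ a) = f a) : f.GNS →L[ℂ] f.GNS :=
  (preKoopman f Φ h).toContinuousLinearMap.completion

/-- The cyclic vector of the GNS representation. -/
def cyclicVector (f : A →ₚ[ℂ] ℂ) : f.GNS := (f.toPreGNS 1 : f.PreGNS)

theorem koopman_gns (f : A →ₚ[ℂ] ℂ) (Φ : A →⋆ₐ[ℂ] A) (h : ∀ a, f (Φ a) = f a) (a : A) :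
  koopman f Φ h (f.gnsStarAlgHom a (cyclicVector f)) = f.gnsStarAlgHom (Φ a) (cyclicVector f) := by
  have h1 (b : A) : f.gnsStarAlgHom b (cyclicVector f) = (f.toPreGNS b : f.PreGNS) := by
    refine (f.gnsNonUnitalStarAlgHom_apply_coe (a := b) (b := f.toPreGNS 1)).trans ?_
    simp
  rw [h1, h1]
  exact ContinuousLinearMap.completion_apply_coe _ _


/-- `(A, Φ, φ)` is ergodic: `φ` is a `Φ`-invariant state, and the vectors of its GNS space that
are fixed by the operator implementing `Φ` are the multiples of the cyclic vector. -/
def IsErgodic (Φ : A →⋆ₐ[ℂ] A) (φ : A →L[ℂ] ℂ) : Prop :=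
  ∃ h : φ ∈ invariantStates Φ,
    {ξ : (toPositive φ h.1).GNS | koopman (toPositive φ h.1) Φ h.2 ξ = ξ} =
      Submodule.span ℂ {cyclicVector (toPositive φ h.1)}

/-- `φ` is an ergodic state: an extreme point of the convex set of invariant states. -/
def IsErgodicState (Φ : A →⋆ₐ[ℂ] A) (φ : A →L[ℂ] ℂ) : Prop :=
  φ ∈ (invariantStates Φ).extremePoints ℝ

/-- `(A, Φ)` is uniquely ergodic, and `φ` is its unique invariant state. -/
def IsUniquelyErgodic (Φ : A →⋆ₐ[ℂ] A) (φ : A →L[ℂ] ℂ) : Prop := invariantStates Φ = {φ}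

end CStarDynamics

open CStarDynamics

namespace NCTorus

open scoped ComplexConjugate

/-- The group `*`-algebra of the free group on two letters, that is, the free unital complex
`*`-algebra on two unitaries. The parameter `α` only serves to equip it with a norm later. -/
def Poly (_α : ℝ) : Type := MonoidAlgebra ℂ (FreeGroup Bool)

variable {α : ℝ}

instance (α : ℝ) : Ring (Poly α) := inferInstanceAs (Ring (MonoidAlgebra ℂ (FreeGroup Bool)))
instance (α : ℝ) : Algebra ℂ (Poly α) :=
  inferInstanceAs (Algebra ℂ (MonoidAlgebra ℂ (FreeGroup Bool)))

namespace Poly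

/-- The element `c g`, for a scalar `c` and a word `g`. -/
def mon (α : ℝ) (c : ℂ) (g : FreeGroup Bool) : Poly α := MonoidAlgebra.single g c

theorem mon_mul (c d : ℂ) (g h : FreeGroup Bool) :
    mon α c g * mon α d h = mon α (c * d) (g * h) := MonoidAlgebra.single_mul_single ..

theorem one_eq : (1 : Poly α) = mon α 1 1 := rfl

theorem smul_mon (c d : ℂ) (g : FreeGroup Bool) : c • mon α d g = mon α (c * d) g := by
  exact MonoidAlgebra.smul_single ..

theorem induction {P : Poly α → Prop} (h0 : P 0) (hadd : ∀ x y, P x → P y → P (x + y))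
    (hmon : ∀ c g, P (mon α c g)) (x : Poly α) : P x :=
  MonoidAlgebra.induction_linear x h0 hadd (fun g c => hmon c g)

/-- The involution, `c g ↦ conj c g⁻¹`. -/
def starHom (α : ℝ) : Poly α →+ Poly α where
  toFun x := MonoidAlgebra.coeff x |>.sum fun g c => mon α (conj c) g⁻¹
  map_zero' := by
    exact Finsupp.sum_zero_index
  map_add' x y := by
    refine Finsupp.sum_add_index' (fun g => ?_) (fun g c d => ?_)
    · simp [mon]; rfl
    · simp [mon]; rfl

theorem starHom_mon (c : ℂ) (g : FreeGroup Bool) :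
    starHom α (mon α c g) = mon α (conj c) g⁻¹ := by
  refine (Finsupp.sum_single_index (h := fun g c => mon α (conj c) g⁻¹) ?_)
  simp [mon]; rfl

instance : StarRing (Poly α) where
  star := starHom α
  star_involutive x := by
    show starHom α (starHom α x) = x
    induction x using induction with
    | h0 => simp
    | hadd x y hx hy => simp [hx, hy]
    | hmon c g => simp [starHom_mon]
  star_mul x y := by
    show starHom α (x * y) = starHom α y * starHom α x
    induction x using induction with
    | h0 => simp
    | hadd x x' hx hx' => simp [add_mul, mul_add, hx, hx']
    | hmon c g =>
      induction y using induction with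
      | h0 => simp
      | hadd y y' hy hy' => simp [add_mul, mul_add, hy, hy']
      | hmon d h => simp [starHom_mon, mon_mul, mul_comm]
  star_add := (starHom α).map_add

theorem star_mon (c : ℂ) (g : FreeGroup Bool) : star (mon α c g) = mon α (conj c) g⁻¹ :=
  starHom_mon c g

instance : StarModule ℂ (Poly α) where
  star_smul c x := by
    induction x using induction with
    | h0 => simp
    | hadd x y hx hy => simp [hx, hy]
    | hmon d g => simp [smul_mon, star_mon]

/-- The first free unitary. -/
def u (α : ℝ) : Poly α := mon α 1 (FreeGroup.of true)
/-- The second free unitary. -/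
def v (α : ℝ) : Poly α := mon α 1 (FreeGroup.of false)

end Poly

/-- The number `e^{2πiα}`. -/
def phase (α : ℝ) : ℂ := Complex.exp (2 * Real.pi * Complex.I * α)

/-- A C⋆-seminorm on the free unital `*`-algebra on two unitaries `u, v` for which the relation
`u v = e^{2πiα} v u` holds. -/
structure IsCStarSeminorm (α : ℝ) (p : Seminorm ℂ (Poly α)) : Prop where
  mul_le : ∀ x y, p (x * y) ≤ p x * p y
  star_mul_self : ∀ x, p (star x * x) = p x ^ 2
  rel : p (Poly.u α * Poly.v α - phase α • (Poly.v α * Poly.u α)) = 0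

theorem IsCStarSeminorm.mon_le {p : Seminorm ℂ (Poly α)} (hp : IsCStarSeminorm α p) (c : ℂ)
    (g : FreeGroup Bool) : p (Poly.mon α c g) ≤ ‖c‖ := by
  have h1 : p 1 ≤ 1 := by
    have := hp.star_mul_self 1
    simp only [star_one, mul_one] at this
    nlinarith [sq_nonneg (p 1 - 1)]
  have h2 : p (Poly.mon α 1 g) ≤ 1 := by
    have := hp.star_mul_self (Poly.mon α 1 g)
    simp only [Poly.star_mon, Poly.mon_mul, map_one, mul_one, inv_mul_cancel, ← Poly.one_eq] at this
    exact abs_le_one_iff_mul_self_le_one.2 (by nlinarith) |> (le_abs_self _).trans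
  have h3 : Poly.mon α c g = c • Poly.mon α 1 g := by simp [Poly.smul_mon]
  rw [h3, map_smul_eq_mul]
  exact mul_le_of_le_one_right (norm_nonneg _) h2

theorem IsCStarSeminorm.zero (α : ℝ) : IsCStarSeminorm α 0 where
  mul_le := by simp
  star_mul_self := by simp
  rel := by simp

instance : Nonempty {p : Seminorm ℂ (Poly α) // IsCStarSeminorm α p} := ⟨⟨0, .zero α⟩⟩

theorem bddAbove (x : Poly α) :
    BddAbove (Set.range fun p : {p : Seminorm ℂ (Poly α) // IsCStarSeminorm α p} => p.1 x) := by
  suffices ∃ C : ℝ, ∀ p : Seminorm ℂ (Poly α), IsCStarSeminorm α p → p x ≤ C by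
    obtain ⟨C, hC⟩ := this
    exact ⟨C, by rintro _ ⟨p, rfl⟩; exact hC p.1 p.2⟩
  induction x using Poly.induction with
  | h0 => exact ⟨0, by simp⟩
  | hadd x y hx hy =>
    obtain ⟨C, hC⟩ := hx
    obtain ⟨D, hD⟩ := hy
    exact ⟨C + D, fun p hp => (map_add_le_add p x y).trans (add_le_add (hC p hp) (hD p hp))⟩
  | hmon c g => exact ⟨‖c‖, fun p hp => hp.mon_le c g⟩

/-- The universal C⋆-seminorm: the supremum of all C⋆-seminorms for which the relation holds. -/
def maxNorm (x : Poly α) : ℝ :=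
  ⨆ p : {p : Seminorm ℂ (Poly α) // IsCStarSeminorm α p}, p.1 x

theorem IsCStarSeminorm.le_maxNorm {p : Seminorm ℂ (Poly α)} (hp : IsCStarSeminorm α p)
    (x : Poly α) : p x ≤ maxNorm x := le_ciSup (bddAbove x) ⟨p, hp⟩

theorem maxNorm_nonneg (x : Poly α) : 0 ≤ maxNorm x := Real.iSup_nonneg fun p => apply_nonneg p.1 x

theorem maxNorm_mul_le (x y : Poly α) : maxNorm (x * y) ≤ maxNorm x * maxNorm y :=
  ciSup_le fun p => (p.2.mul_le x y).trans <|
    mul_le_mul (p.2.le_maxNorm x) (p.2.le_maxNorm y) (apply_nonneg _ _) (maxNorm_nonneg x)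

theorem maxNorm_star_mul_self (x : Poly α) : maxNorm x * maxNorm x ≤ maxNorm (star x * x) := by
  have h : maxNorm x ≤ √(maxNorm (star x * x)) := by
    refine ciSup_le fun p => Real.le_sqrt_of_sq_le ?_
    rw [← p.2.star_mul_self]
    exact p.2.le_maxNorm _
  have := mul_self_le_mul_self (maxNorm_nonneg x) h
  rwa [Real.mul_self_sqrt (maxNorm_nonneg _)] at this

theorem maxNorm_le_star (x : Poly α) : maxNorm x ≤ maxNorm (star x) := by
  by_contra! h
  have h1 := (maxNorm_star_mul_self x).trans (maxNorm_mul_le _ _)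
  nlinarith [maxNorm_nonneg (star x)]

theorem maxNorm_star (x : Poly α) : maxNorm (star x) = maxNorm x :=
  le_antisymm (by simpa using maxNorm_le_star (star x)) (maxNorm_le_star x)

theorem maxNorm_add_le (x y : Poly α) : maxNorm (x + y) ≤ maxNorm x + maxNorm y :=
  ciSup_le fun p => (map_add_le_add p.1 x y).trans <|
    add_le_add (p.2.le_maxNorm x) (p.2.le_maxNorm y)

theorem maxNorm_smul_le (c : ℂ) (x : Poly α) : maxNorm (c • x) ≤ ‖c‖ * maxNorm x :=
  ciSup_le fun p => by
    rw [map_smul_eq_mul]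
    exact mul_le_mul_of_nonneg_left (p.2.le_maxNorm x) (norm_nonneg c)

instance : SeminormedRing (Poly α) :=
  RingSeminorm.toSeminormedRing
    { toFun := maxNorm
      map_zero' := by simp [maxNorm]
      add_le' := maxNorm_add_le
      neg' := fun x => by simp [maxNorm]
      mul_le' := maxNorm_mul_le }

theorem Poly.norm_def (x : Poly α) : ‖x‖ = maxNorm x := rfl

instance : NormedAlgebra ℂ (Poly α) where
  norm_smul_le := maxNorm_smul_le

instance : NormedStarGroup (Poly α) where
  norm_star_le x := (maxNorm_star x).le

end NCTorus

/-- The noncommutative torus: the universal unital C⋆-algebra generated by two unitaries `U, V`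
with `U V = e^{2πiα} V U`, constructed as the Hausdorff completion of the free unital `*`-algebra
on two unitaries for the universal C⋆-seminorm. -/
def NCTorus (α : ℝ) : Type := UniformSpace.Completion (NCTorus.Poly α)

namespace NCTorus

open UniformSpace

variable {α : ℝ}

instance : NormedRing (NCTorus α) := inferInstanceAs (NormedRing (Completion (Poly α)))
instance : CompleteSpace (NCTorus α) := inferInstanceAs (CompleteSpace (Completion (Poly α)))

/-- The canonical map into the completion. -/
def ofPoly : Poly α → NCTorus α := ((↑) : Poly α → Completion (Poly α))

instance : NormedAlgebra ℂ (NCTorus α) where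
  __ : Algebra ℂ (NCTorus α) := inferInstanceAs (Algebra ℂ (Completion (Poly α)))
  norm_smul_le c x := norm_smul_le (β := Completion (Poly α)) c x

theorem ofPoly_add (x y : Poly α) : ofPoly (x + y) = ofPoly x + ofPoly y := Completion.coe_add x y
theorem ofPoly_mul (x y : Poly α) : ofPoly (x * y) = ofPoly x * ofPoly y := Completion.coe_mul x y
theorem ofPoly_one : ofPoly (1 : Poly α) = 1 := rfl
theorem ofPoly_smul (c : ℂ) (x : Poly α) : ofPoly (c • x) = c • ofPoly x := Completion.coe_smul c x
theorem norm_ofPoly (x : Poly α) : ‖ofPoly x‖ = ‖x‖ := Completion.norm_coe x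
theorem continuous_ofPoly : Continuous (ofPoly (α := α)) := Completion.continuous_coe _
theorem denseRange_ofPoly : DenseRange (ofPoly (α := α)) := Completion.denseRange_coe

/-- The involution of the noncommutative torus. -/
def starMap (α : ℝ) : NCTorus α → NCTorus α :=
  Completion.map (star : Poly α → Poly α)

theorem starMap_ofPoly (x : Poly α) : starMap α (ofPoly x) = ofPoly (star x) :=
  Completion.map_coe (starₗᵢ ℂ : Poly α ≃ₗᵢ⋆[ℂ] Poly α).isometry.uniformContinuous x


theorem continuous_starMap : Continuous (starMap α) := Completion.continuous_map

theorem dense_induction {P : NCTorus α → Prop} (hc : IsClosed {x | P x})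
    (h : ∀ x : Poly α, P (ofPoly x)) (x : NCTorus α) : P x :=
  Completion.induction_on x hc h

theorem dense_induction₂ {P : NCTorus α → NCTorus α → Prop}
    (hc : IsClosed {x : NCTorus α × NCTorus α | P x.1 x.2})
    (h : ∀ x y : Poly α, P (ofPoly x) (ofPoly y)) (x y : NCTorus α) : P x y :=
  Completion.induction_on₂ x y hc h

instance : StarRing (NCTorus α) where
  star := starMap α
  star_involutive x := by
    have hc := continuous_starMap (α := α)
    show starMap α (starMap α x) = x
    refine dense_induction (P := fun x => starMap α (starMap α x) = x)
      (isClosed_eq (hc.comp hc) continuous_id) (fun x => ?_) x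
    simp [starMap_ofPoly]
  star_mul x y := by
    have hc := continuous_starMap (α := α)
    show starMap α (x * y) = starMap α y * starMap α x
    refine dense_induction₂ (P := fun x y => starMap α (x * y) = starMap α y * starMap α x)
      (isClosed_eq (by fun_prop) (by fun_prop)) (fun x y => ?_) x y
    simp [starMap_ofPoly, ← ofPoly_mul]
  star_add x y := by
    have hc := continuous_starMap (α := α)
    show starMap α (x + y) = starMap α x + starMap α y
    refine dense_induction₂ (P := fun x y => starMap α (x + y) = starMap α x + starMap α y)
      (isClosed_eq (by fun_prop) (by fun_prop)) (fun x y => ?_) x y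
    simp [starMap_ofPoly, ← ofPoly_add]

theorem star_ofPoly (x : Poly α) : star (ofPoly x) = ofPoly (star x) := starMap_ofPoly x

theorem continuous_star_aux : Continuous (star : NCTorus α → NCTorus α) := continuous_starMap

instance : StarModule ℂ (NCTorus α) where
  star_smul c := dense_induction (P := fun x => star (c • x) = star c • star x)
    (isClosed_eq (continuous_star_aux.comp (continuous_const_smul c))
      (continuous_star_aux.const_smul (star c))) fun x => by
    rw [← ofPoly_smul, star_ofPoly, star_ofPoly, ← ofPoly_smul, star_smul]

instance : CStarRing (NCTorus α) where
  norm_mul_self_le := dense_induction (P := fun x => ‖x‖ * ‖x‖ ≤ ‖star x * x‖)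
    (isClosed_le (continuous_norm.mul continuous_norm)
      (continuous_norm.comp (continuous_star_aux.mul continuous_id))) fun x => by
    rw [star_ofPoly, ← ofPoly_mul, norm_ofPoly, norm_ofPoly]
    exact maxNorm_star_mul_self x

instance : CStarAlgebra (NCTorus α) where

instance : PartialOrder (NCTorus α) := CStarAlgebra.spectralOrder _
instance : StarOrderedRing (NCTorus α) := CStarAlgebra.spectralOrderedRing _

/-- The canonical map into the completion, as a `*`-homomorphism. -/
def ofPolyHom (α : ℝ) : Poly α →⋆ₐ[ℂ] NCTorus α where
  toFun := ofPoly
  map_one' := rfl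
  map_mul' := ofPoly_mul
  map_zero' := rfl
  map_add' := ofPoly_add
  commutes' c := by
    rw [Algebra.algebraMap_eq_smul_one, Algebra.algebraMap_eq_smul_one, ofPoly_smul, ofPoly_one]
  map_star' x := (star_ofPoly x).symm

theorem Poly.u_mem (α : ℝ) : Poly.u α ∈ unitary (Poly α) := by
  simp [Unitary.mem_iff, Poly.u, Poly.star_mon, Poly.mon_mul, Poly.one_eq]

theorem Poly.v_mem (α : ℝ) : Poly.v α ∈ unitary (Poly α) := by
  simp [Unitary.mem_iff, Poly.v, Poly.star_mon, Poly.mon_mul, Poly.one_eq]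

/-- The generator `U`. -/
def U (α : ℝ) : unitary (NCTorus α) :=
  ⟨ofPolyHom α (Poly.u α), Unitary.map_mem (ofPolyHom α) (Poly.u_mem α)⟩
/-- The generator `V`. -/
def V (α : ℝ) : unitary (NCTorus α) :=
  ⟨ofPolyHom α (Poly.v α), Unitary.map_mem (ofPolyHom α) (Poly.v_mem α)⟩

theorem U_mul_V (α : ℝ) :
    (U α * V α : NCTorus α) = phase α • (V α * U α : NCTorus α) := by
  have h : maxNorm (Poly.u α * Poly.v α - phase α • (Poly.v α * Poly.u α)) = 0 := by
    unfold maxNorm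
    simp_rw [fun p : {p : Seminorm ℂ (Poly α) // IsCStarSeminorm α p} => p.2.rel]
    simp
  rw [← Poly.norm_def, ← norm_ofPoly, norm_eq_zero] at h
  have h2 : ofPolyHom α (Poly.u α * Poly.v α - phase α • (Poly.v α * Poly.u α)) = 0 := h
  rw [map_sub, map_smul, map_mul, map_mul, sub_eq_zero] at h2
  exact h2

section lift

variable {B : Type*} [CStarAlgebra B]

/-- The relation `a b = e^{2πiα} b a`. -/
def Rel (α : ℝ) (a b : unitary B) : Prop := (a * b : B) = phase α • (b * a : B)

/-- The homomorphism on the free `*`-algebra that sends the generators to `a` and `b`. -/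
def polyLiftAlgHom (α : ℝ) (a b : unitary B) : Poly α →ₐ[ℂ] B :=
  MonoidAlgebra.lift ℂ B (FreeGroup Bool)
    ((unitary B).subtype.comp (FreeGroup.lift fun i => bif i then a else b))

theorem polyLiftAlgHom_mon (a b : unitary B) (c : ℂ) (g : FreeGroup Bool) :
    polyLiftAlgHom α a b (Poly.mon α c g) =
      c • (FreeGroup.lift (fun i => bif i then a else b) g : B) :=
  MonoidAlgebra.lift_single _ _ _

/-- The homomorphism on the free `*`-algebra that sends the generators to `a` and `b`. -/
def polyLift (α : ℝ) (a b : unitary B) : Poly α →⋆ₐ[ℂ] B where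
  __ := polyLiftAlgHom α a b
  map_star' x := by
    show polyLiftAlgHom α a b (star x) = star (polyLiftAlgHom α a b x)
    induction x using Poly.induction with
    | h0 => simp
    | hadd x y hx hy => simp [hx, hy]
    | hmon c g => rw [Poly.star_mon, polyLiftAlgHom_mon, polyLiftAlgHom_mon, star_smul, map_inv]; rfl

theorem polyLift_u (a b : unitary B) : polyLift α a b (Poly.u α) = a := by
  refine (polyLiftAlgHom_mon a b 1 _).trans ?_
  simp

theorem polyLift_v (a b : unitary B) : polyLift α a b (Poly.v α) = b := by
  refine (polyLiftAlgHom_mon a b 1 _).trans ?_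
  simp

theorem norm_polyLift_le {a b : unitary B} (h : Rel α a b) (x : Poly α) :
    ‖polyLift α a b x‖ ≤ ‖x‖ := by
  let p : Seminorm ℂ (Poly α) :=
    Seminorm.of (fun x => ‖polyLift α a b x‖) (fun x y => by simpa using norm_add_le _ _)
      (fun c x => by simp [norm_smul])
  have hp : IsCStarSeminorm α p :=
    { mul_le := fun x y => by
        show ‖polyLift α a b (x * y)‖ ≤ ‖polyLift α a b x‖ * ‖polyLift α a b y‖
        rw [map_mul]
        exact norm_mul_le _ _
      star_mul_self := fun x => by
        show ‖polyLift α a b (star x * x)‖ = ‖polyLift α a b x‖ ^ 2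
        rw [map_mul, map_star, CStarRing.norm_star_mul_self, sq]
      rel := by
        show ‖polyLift α a b _‖ = 0
        rw [map_sub, map_smul, map_mul, map_mul, polyLift_u, polyLift_v, norm_eq_zero, sub_eq_zero]
        exact h }
  exact hp.le_maxNorm x

theorem continuous_polyLift {a b : unitary B} (h : Rel α a b) : Continuous (polyLift α a b) :=
  AddMonoidHomClass.continuous_of_bound (polyLift α a b) 1 fun x => by
    simpa using norm_polyLift_le h x

/-- The extension of `polyLift` to the completion. -/
def liftRingHom {a b : unitary B} (h : Rel α a b) : NCTorus α →+* B :=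
  (Completion.extensionHom ((polyLift α a b).toRingHom) (continuous_polyLift h))

theorem continuous_liftRingHom {a b : unitary B} (h : Rel α a b) : Continuous (liftRingHom h) :=
  Completion.continuous_extension

theorem liftRingHom_ofPoly {a b : unitary B} (h : Rel α a b) (x : Poly α) :
    liftRingHom h (ofPoly x) = polyLift α a b x :=
  Completion.extensionHom_coe _ (continuous_polyLift h) x

/-- The `*`-homomorphism given by the universal property. -/
def lift {a b : unitary B} (h : Rel α a b) : NCTorus α →⋆ₐ[ℂ] B where
  __ := liftRingHom h
  commutes' c := by
    show liftRingHom h (algebraMap ℂ (NCTorus α) c) = _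
    rw [← AlgHomClass.commutes (ofPolyHom α) c]
    refine (liftRingHom_ofPoly h _).trans ?_
    exact AlgHomClass.commutes _ c
  map_star' := by
    show ∀ x, liftRingHom h (star x) = star (liftRingHom h x)
    have hc := continuous_liftRingHom h
    refine dense_induction (isClosed_eq (hc.comp continuous_star_aux) hc.star) fun x => ?_
    rw [star_ofPoly, liftRingHom_ofPoly, liftRingHom_ofPoly, map_star]

theorem lift_U {a b : unitary B} (h : Rel α a b) : lift h (U α) = a :=
  (liftRingHom_ofPoly h _).trans (polyLift_u a b)

theorem lift_V {a b : unitary B} (h : Rel α a b) : lift h (V α) = b :=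
  (liftRingHom_ofPoly h _).trans (polyLift_v a b)

theorem continuous_hom (φ : NCTorus α →⋆ₐ[ℂ] B) : Continuous φ :=
  AddMonoidHomClass.continuous_of_bound φ 1 fun x => by
    simpa using NonUnitalStarAlgHom.norm_apply_le φ x

theorem polyHom_ext {φ ψ : Poly α →⋆ₐ[ℂ] B} (hu : φ (Poly.u α) = ψ (Poly.u α))
    (hv : φ (Poly.v α) = ψ (Poly.v α)) : φ = ψ := by
  ext x
  induction x using Poly.induction with
  | h0 => simp
  | hadd x y hx hy => simp [hx, hy]
  | hmon c g =>
    have hg : φ (Poly.mon α 1 g) = ψ (Poly.mon α 1 g) := by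
      induction g using FreeGroup.induction_on with
      | C1 => rw [← Poly.one_eq, map_one, map_one]
      | of i => cases i <;> assumption
      | inv_of i h =>
        have h' := congrArg star h
        simpa only [← map_star, Poly.star_mon, map_one] using h'
      | mul g h hg hh =>
        have : Poly.mon α 1 (g * h) = Poly.mon α 1 g * Poly.mon α 1 h := by
          rw [Poly.mon_mul, one_mul]
        rw [this, map_mul, map_mul, hg, hh]
    have h : Poly.mon α c g = c • Poly.mon α 1 g := by simp [Poly.smul_mon]
    rw [h, map_smul, map_smul, hg]

theorem hom_ext {φ ψ : NCTorus α →⋆ₐ[ℂ] B} (hU : φ (U α) = ψ (U α)) (hV : φ (V α) = ψ (V α)) :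
    φ = ψ := by
  have h : φ.comp (ofPolyHom α) = ψ.comp (ofPolyHom α) := polyHom_ext hU hV
  ext x
  refine dense_induction (P := fun x => φ x = ψ x)
    (isClosed_eq (continuous_hom φ) (continuous_hom ψ)) (fun x => ?_) x
  exact DFunLike.congr_fun h x

/-- The universal property of the noncommutative torus. -/
theorem existsUnique_hom {a b : unitary B} (h : (a * b : B) = phase α • (b * a : B)) :
    ∃! φ : NCTorus α →⋆ₐ[ℂ] B, φ (U α) = a ∧ φ (V α) = b :=
  ⟨lift h, ⟨lift_U h, lift_V h⟩, fun _ hφ =>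
    hom_ext (hφ.1.trans (lift_U h).symm) (hφ.2.trans (lift_V h).symm)⟩

end lift

section regularRepresentation

open scoped ENNReal ComplexOrder InnerProductSpace

/-- The Hilbert space `ℓ²(ℤ × ℤ)`. -/
abbrev L2Z2 : Type := lp (fun _ : ℤ × ℤ => ℂ) 2

theorem memℓp_weighted (c : ℤ × ℤ → Circle) (σ : Equiv.Perm (ℤ × ℤ)) (x : L2Z2) :
    Memℓp (fun i => (c i : ℂ) * x (σ i)) 2 := by
  have h := (memℓp_gen_iff (by norm_num)).1 (lp.memℓp x)
  refine (memℓp_gen_iff (by norm_num)).2 ?_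
  simp only [norm_mul, Circle.norm_coe, one_mul]
  exact σ.summable_iff.2 h

/-- The weighted permutation operator `(W x)(i) = c i * x (σ i)` on `ℓ²(ℤ × ℤ)`. -/
def weightedPerm (c : ℤ × ℤ → Circle) (σ : Equiv.Perm (ℤ × ℤ)) : L2Z2 ≃ₗᵢ[ℂ] L2Z2 where
  toFun x := ⟨fun i => (c i : ℂ) * x (σ i), memℓp_weighted c σ x⟩
  invFun x := ⟨fun i => (((c (σ.symm i))⁻¹ : Circle) : ℂ) * x (σ.symm i),
    memℓp_weighted (fun i => (c (σ.symm i))⁻¹) σ.symm x⟩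
  left_inv x := by ext i; simp
  right_inv x := by ext i; simp
  map_add' x y := by ext i; exact mul_add _ _ _
  map_smul' a x := by ext i; simp [mul_left_comm]
  norm_map' x := by
    rw [lp.norm_eq_tsum_rpow (by norm_num), lp.norm_eq_tsum_rpow (by norm_num)]
    congr 1
    rw [← σ.tsum_eq (fun i => ‖x i‖ ^ (2 : ℝ≥0∞).toReal)]
    refine tsum_congr fun i => ?_
    show ‖(c i : ℂ) * x (σ i)‖ ^ _ = _
    rw [norm_mul, Circle.norm_coe, one_mul]

theorem weightedPerm_apply (c : ℤ × ℤ → Circle) (σ : Equiv.Perm (ℤ × ℤ)) (x : L2Z2) (i : ℤ × ℤ) :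
    weightedPerm c σ x i = c i * x (σ i) := rfl

/-- The shift `e (m, n) ↦ e (m + 1, n)`. -/
def regU : unitary (L2Z2 →L[ℂ] L2Z2) :=
  Unitary.linearIsometryEquiv.symm (weightedPerm 1 (Equiv.addRight (-1, 0)))

/-- The weighted shift `e (m, n) ↦ e^{-2πiαm} e (m, n + 1)`. -/
def regV (α : ℝ) : unitary (L2Z2 →L[ℂ] L2Z2) :=
  Unitary.linearIsometryEquiv.symm
    (weightedPerm (fun i => Circle.exp (2 * Real.pi * α) ^ (-i.1)) (Equiv.addRight (0, -1)))

theorem regU_apply (x : L2Z2) (i : ℤ × ℤ) :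
    (regU : L2Z2 →L[ℂ] L2Z2) x i = x (i + (-1, 0)) :=
  one_mul _

theorem regV_apply (α : ℝ) (x : L2Z2) (i : ℤ × ℤ) :
    (regV α : L2Z2 →L[ℂ] L2Z2) x i =
      (Circle.exp (2 * Real.pi * α) ^ (-i.1) : Circle) * x (i + (0, -1)) := rfl

theorem phase_eq (α : ℝ) : phase α = Circle.exp (2 * Real.pi * α) := by
  rw [phase, Circle.coe_exp]; congr 1; push_cast; ring

theorem reg_rel (α : ℝ) : (regU * regV α : L2Z2 →L[ℂ] L2Z2) = phase α • (regV α * regU : L2Z2 →L[ℂ] L2Z2) := by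
  ext x i
  show (regU : L2Z2 →L[ℂ] L2Z2) ((regV α : L2Z2 →L[ℂ] L2Z2) x) i =
    phase α * (regV α : L2Z2 →L[ℂ] L2Z2) ((regU : L2Z2 →L[ℂ] L2Z2) x) i
  rw [regU_apply, regV_apply, regV_apply, regU_apply, phase_eq, ← mul_assoc, ← Circle.coe_mul,
    ← zpow_one_add]
  have h1 : -(i + (-1, 0)).1 = 1 + -i.1 := by simp
  have h2 : i + (-1, 0) + (0, -1) = i + (0, -1) + (-1, 0) := by abel
  rw [h1, h2]


theorem regV_single (α : ℝ) (n : ℤ) :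
    (regV α : L2Z2 →L[ℂ] L2Z2) (lp.single 2 (0, n) 1) = lp.single 2 (0, n + 1) 1 := by
  ext i
  rw [regV_apply, lp.single_apply, lp.single_apply]
  obtain ⟨a, b⟩ := i
  by_cases ha : a = 0
  · subst ha
    simp [Pi.single_apply, ← sub_eq_add_neg, sub_eq_iff_eq_add]
  · simp [ha]

theorem regU_single (m n : ℤ) :
    (regU : L2Z2 →L[ℂ] L2Z2) (lp.single 2 (m, n) 1) = lp.single 2 (m + 1, n) 1 := by
  ext i
  rw [regU_apply, lp.single_apply, lp.single_apply]
  obtain ⟨a, b⟩ := i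
  simp [Pi.single_apply, ← sub_eq_add_neg, sub_eq_iff_eq_add]

theorem zpow_shift (w : unitary (L2Z2 →L[ℂ] L2Z2)) (s : ℤ → L2Z2)
    (h : ∀ n, (w : L2Z2 →L[ℂ] L2Z2) (s n) = s (n + 1)) (k : ℤ) :
    ((w ^ k : unitary (L2Z2 →L[ℂ] L2Z2)) : L2Z2 →L[ℂ] L2Z2) (s 0) = s k := by
  have h' (n : ℤ) : ((w⁻¹ : unitary (L2Z2 →L[ℂ] L2Z2)) : L2Z2 →L[ℂ] L2Z2) (s (n + 1)) = s n := by
    rw [← h]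
    have : ((w⁻¹ * w : unitary (L2Z2 →L[ℂ] L2Z2)) : L2Z2 →L[ℂ] L2Z2) (s n) = s n := by
      rw [inv_mul_cancel]; rfl
    exact this
  induction k using Int.induction_on with
  | zero => rfl
  | succ k ih =>
    rw [add_comm, zpow_add, zpow_one, add_comm, ← h, ← ih]; rfl
  | pred k ih =>
    rw [sub_eq_neg_add, zpow_add, zpow_neg_one, ← h' (-1 + _), ← sub_eq_neg_add, sub_add_cancel, ← ih]; rfl


/-- The representation of the noncommutative torus by the two shifts. -/
def regularRep (α : ℝ) : NCTorus α →⋆ₐ[ℂ] (L2Z2 →L[ℂ] L2Z2) := lift (reg_rel α)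

/-- The canonical trace `τ`, as the vector state of `e (0, 0)`. It is the bounded functional with
`τ (U ^ m * V ^ n) = δ_{m,0} δ_{n,0}`, by `trace_zpow`. -/
def trace (α : ℝ) : NCTorus α →L[ℂ] ℂ where
  toFun x := ⟪(lp.single 2 (0, 0) 1 : L2Z2), regularRep α x (lp.single 2 (0, 0) 1)⟫_ℂ
  map_add' x y := by rw [map_add, add_apply, inner_add_right]
  map_smul' c x := by
    rw [map_smul, smul_apply, inner_smul_right]; rfl
  cont := by
    have := continuous_hom (regularRep α)
    fun_prop

theorem trace_apply (x : NCTorus α) : trace α x =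
    ⟪(lp.single 2 (0, 0) 1 : L2Z2), regularRep α x (lp.single 2 (0, 0) 1)⟫_ℂ := rfl

theorem trace_mem_stateSpace (α : ℝ) : trace α ∈ stateSpace (NCTorus α) := by
  constructor
  · intro a ha
    obtain ⟨b, rfl⟩ := CStarAlgebra.nonneg_iff_eq_star_mul_self.1 ha
    rw [trace_apply, map_mul, map_star, ContinuousLinearMap.star_eq_adjoint,
      mul_apply_eq_comp, ContinuousLinearMap.adjoint_inner_right]
    exact inner_self_eq_norm_sq_to_K (𝕜 := ℂ) (regularRep α b (lp.single 2 (0, 0) 1)) ▸ by positivity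
  · rw [trace_apply, map_one, one_apply_eq_self, inner_self_eq_norm_sq_to_K,
      lp.norm_single (by norm_num)]
    simp

theorem trace_zpow (α : ℝ) (m n : ℤ) :
    trace α ((U α ^ m * V α ^ n : unitary (NCTorus α)) : NCTorus α) =
      if m = 0 ∧ n = 0 then 1 else 0 := by
  have h (w : unitary (NCTorus α)) (k : ℤ) :
      regularRep α ((w ^ k : unitary (NCTorus α)) : NCTorus α) =
        ((mapUnitary (regularRep α) w ^ k : unitary (L2Z2 →L[ℂ] L2Z2)) : L2Z2 →L[ℂ] L2Z2) := by
    exact congrArg Subtype.val (map_zpow (mapUnitary (regularRep α)) w k)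
  have hU : mapUnitary (regularRep α) (U α) = regU := Subtype.ext (lift_U _)
  have hV : mapUnitary (regularRep α) (V α) = regV α := Subtype.ext (lift_V _)
  have e : regularRep α ((U α ^ m * V α ^ n : unitary (NCTorus α)) : NCTorus α)
      (lp.single 2 (0, 0) 1) = lp.single 2 (m, n) 1 := by
    rw [Submonoid.coe_mul, map_mul, h, h, hU, hV, mul_apply_eq_comp,
      zpow_shift (regV α) (fun n => lp.single 2 (0, n) 1) (regV_single α) n]
    exact zpow_shift regU (fun m => lp.single 2 (m, n) 1) (fun m => regU_single m n) m
  rw [trace_apply, e, lp.inner_single_left]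
  simp [Pi.single_apply, eq_comm]

end regularRepresentation

section anzai

theorem anzai_rel (α θ : ℝ) (f : C(Circle, Circle)) :
    Rel α (scaleUnitary (Circle.exp θ) (U α)) (unitaryCalculus (U α) f * V α) := by
  have h := commute_unitaryCalculus (U α) f
  have h' : (U α : NCTorus α) * unitaryCalculus (U α) f = unitaryCalculus (U α) f * U α :=
    congrArg Subtype.val h.eq
  have hr := U_mul_V α
  simp only [Rel, scaleUnitary, Submonoid.coe_mul, smul_mul_assoc, mul_smul_comm]
  rw [← mul_assoc, h', mul_assoc, hr, mul_smul_comm, smul_comm, mul_assoc]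

/-- The `*`-endomorphism with `U ↦ e^{iθ} U` and `V ↦ f(U) V`. -/
def anzaiHom (α θ : ℝ) (f : C(Circle, Circle)) : NCTorus α →⋆ₐ[ℂ] NCTorus α :=
  lift (anzai_rel α θ f)

theorem anzaiHom_U (α θ : ℝ) (f : C(Circle, Circle)) :
    anzaiHom α θ f (U α) = (Circle.exp θ : ℂ) • (U α : NCTorus α) := lift_U _

theorem anzaiHom_V (α θ : ℝ) (f : C(Circle, Circle)) :
    anzaiHom α θ f (V α) = (unitaryCalculus (U α) f : NCTorus α) * V α := lift_V _

theorem anzaiHom_comp (α θ : ℝ) (f g : C(Circle, Circle))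
    (h : g.comp (ContinuousMap.mulLeft (Circle.exp θ)) = f⁻¹) :
    (anzaiHom α θ f).comp (anzaiHom α (-θ) g) = StarAlgHom.id ℂ (NCTorus α) := by
  apply hom_ext
  · simp only [StarAlgHom.comp_apply, anzaiHom_U, map_smul, smul_smul, ← Circle.coe_mul,
      ← Circle.exp_add, neg_add_cancel, Circle.exp_zero, Circle.coe_one, one_smul]
    rfl
  · have hU : mapUnitary (anzaiHom α θ f) (U α) = scaleUnitary (Circle.exp θ) (U α) :=
      Subtype.ext (anzaiHom_U α θ f)
    rw [StarAlgHom.comp_apply, anzaiHom_V, map_mul, anzaiHom_V, map_unitaryCalculus, hU,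
      ← unitaryCalculus_const_mul, h, map_inv, ← mul_assoc, ← Submonoid.coe_mul, inv_mul_cancel]
    simp

/-- The Anzai skew-product: the `*`-automorphism with `U ↦ e^{iθ} U` and `V ↦ f(U) V`. -/
def anzai (α θ : ℝ) (f : C(Circle, Circle)) : NCTorus α ≃⋆ₐ[ℂ] NCTorus α :=
  StarAlgEquiv.ofStarAlgHom (anzaiHom α θ f)
    (anzaiHom α (-θ) (f.comp (ContinuousMap.mulLeft (Circle.exp (-θ))))⁻¹)
    (by
      have := anzaiHom_comp α (-θ) (f.comp (ContinuousMap.mulLeft (Circle.exp (-θ))))⁻¹ f (by simp)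
      rwa [neg_neg] at this)
    (anzaiHom_comp α θ f _ (by
      ext z
      simp [← mul_assoc]))

theorem anzai_U (α θ : ℝ) (f : C(Circle, Circle)) :
    anzai α θ f (U α) = (Circle.exp θ : ℂ) • (U α : NCTorus α) := anzaiHom_U α θ f

theorem anzai_V (α θ : ℝ) (f : C(Circle, Circle)) :
    anzai α θ f (V α) = (unitaryCalculus (U α) f : NCTorus α) * V α := anzaiHom_V α θ f

end anzai

end NCTorus

end

/-!
Modulo scalars the unitaries `U ^ m * V ^ n` form a commutative group, on which the skew product
acts by the shear `(m, n) ↦ (m + l * n, n)`, with `l` the degree of `f`. An invariant state kills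
`U ^ m` for `m ≠ 0`, because `U ^ m` is an eigenvector for the eigenvalue `e^{iθm} ≠ 1`. For
`n ≠ 0` the orbit of `w = U ^ m * V ^ n` satisfies `star w * Φ^k w ∈ 𝕋 U ^ (k * l * n)`, so it is
orthonormal in the pre-GNS space of the state. All its Fourier coefficients against the invariant
vector `1` coincide, so they vanish by Bessel's inequality: the state kills `w` as well and is the
trace.

Ergodicity in the GNS representation is a formal consequence of unique ergodicity. The vector
functional of a fixed unit vector is an invariant state, so `⟪ξ, π(a) ξ⟫ = τ(a) ‖ξ‖²` for every
fixed `ξ`. Polarizing on the space of fixed vectors gives `⟪ξ, π(a) Ω⟫ = τ(a) ⟪ξ, Ω⟫`, and as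
`π(A) Ω` is dense, `ξ` is a multiple of the cyclic vector `Ω`.
-/

noncomputable section

namespace CStarDynamics

open scoped InnerProductSpace ComplexOrder

section Hilbert

variable {𝕜 H : Type*} [RCLike 𝕜] [SeminormedAddCommGroup H] [InnerProductSpace 𝕜 H]

theorem orthonormal_orbit (T : H →ₗᵢ[𝕜] H) {v : H} (hv : ‖v‖ = 1)
    (h : ∀ k > 0, ⟪v, (T ^ k) v⟫_𝕜 = 0) : Orthonormal 𝕜 fun k : ℕ => (T ^ k) v := by
  refine ⟨fun k => ((T ^ k).norm_map v).trans hv, fun i j hij => ?_⟩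
  wlog hlt : i < j generalizing i j
  · exact inner_eq_zero_symm.1 (this j i hij.symm (hij.lt_or_gt.resolve_left hlt))
  obtain ⟨k, rfl⟩ := Nat.exists_eq_add_of_lt hlt
  simp only [add_assoc, pow_add]
  exact ((T ^ i).inner_map_map _ _).trans (h _ k.succ_pos)

theorem inner_eq_zero_of_orthonormal_orbit (T : H →ₗᵢ[𝕜] H) {ξ v : H} (hξ : T ξ = ξ)
    (hv : Orthonormal 𝕜 fun k : ℕ => (T ^ k) v) : ⟪v, ξ⟫_𝕜 = 0 := by
  have hconst (k : ℕ) : ⟪(T ^ k) v, ξ⟫_𝕜 = ⟪v, ξ⟫_𝕜 := by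
    have hξk : (T ^ k) ξ = ξ := by
      rw [LinearIsometry.coe_pow]
      exact Function.iterate_fixed hξ k
    rw [← (T ^ k).inner_map_map v ξ, hξk]
  have hbessel := hv.inner_products_summable (x := ξ)
  simp only [hconst, summable_const_iff] at hbessel
  simpa using hbessel

theorem inner_eq_zero_of_orthogonal_orbit (T : H →ₗᵢ[𝕜] H) {ξ v : H} (hξ : T ξ = ξ)
    (hv : ∀ k > 0, ⟪v, (T ^ k) v⟫_𝕜 = 0) : ⟪v, ξ⟫_𝕜 = 0 := by
  by_cases h0 : ‖v‖ = 0
  · exact inner_eq_zero_of_left ξ h0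
  set r : 𝕜 := (‖v‖ : 𝕜)⁻¹
  have hr : r ≠ 0 := inv_ne_zero (by exact_mod_cast h0)
  have hnorm : ‖r • v‖ = 1 := by simp [r, norm_smul, h0]
  have horth := inner_eq_zero_of_orthonormal_orbit T hξ <| orthonormal_orbit T hnorm fun k hk => by
    rw [map_smul, inner_smul_left, inner_smul_right, hv k hk, mul_zero, mul_zero]
  rw [inner_smul_left] at horth
  exact (mul_eq_zero.1 horth).resolve_left ((map_ne_zero _).2 hr)

theorem inner_map_eq_zero_of_inner_map_self {V : Type*} [SeminormedAddCommGroup V]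
    [InnerProductSpace ℂ V] {p : Submodule ℂ V} {S : V →ₗ[ℂ] V}
    (h : ∀ x ∈ p, ⟪S x, x⟫_ℂ = 0) {x y : V} (hx : x ∈ p) (hy : y ∈ p) : ⟪S x, y⟫_ℂ = 0 := by
  have hI : Complex.I • x ∈ p := p.smul_mem _ hx
  rw [inner_map_polarization, h _ (p.add_mem hy hx), h _ (p.sub_mem hy hx),
    h _ (p.add_mem hy hI), h _ (p.sub_mem hy hI)]
  simp

end Hilbert

section Phases

variable {A B : Type*} [CStarAlgebra A] [CStarAlgebra B]

theorem coe_scaleUnitary (c : Circle) (u : unitary A) :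
    (scaleUnitary c u : A) = (c : ℂ) • (u : A) := rfl

/-- The scalar unitaries, as a homomorphism from the circle. -/
def scalarUnitary (A : Type*) [CStarAlgebra A] : Circle →* unitary A where
  toFun c := scaleUnitary c 1
  map_one' := Subtype.ext (by simp [coe_scaleUnitary])
  map_mul' c d := Subtype.ext (by simp [coe_scaleUnitary, smul_smul, mul_comm])

theorem scalarUnitary_mul (c : Circle) (u : unitary A) :
    scalarUnitary A c * u = scaleUnitary c u :=
  Subtype.ext (by simp [scalarUnitary, coe_scaleUnitary])

theorem mul_scalarUnitary (c : Circle) (u : unitary A) :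
    u * scalarUnitary A c = scaleUnitary c u :=
  Subtype.ext (by simp [scalarUnitary, coe_scaleUnitary])

theorem scaleUnitary_zpow (c : Circle) (u : unitary A) (m : ℤ) :
    scaleUnitary c u ^ m = scaleUnitary (c ^ m) (u ^ m) := by
  have hcomm : Commute (scalarUnitary A c) u :=
    (scalarUnitary_mul c u).trans (mul_scalarUnitary c u).symm
  rw [← scalarUnitary_mul, ← scalarUnitary_mul, hcomm.mul_zpow, map_zpow]

theorem mapUnitary_scaleUnitary (φ : A →⋆ₐ[ℂ] B) (c : Circle) (u : unitary A) :
    mapUnitary φ (scaleUnitary c u) = scaleUnitary c (mapUnitary φ u) :=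
  Subtype.ext (map_smul φ (c : ℂ) (u : A))

instance : (scalarUnitary A).range.Normal where
  conj_mem := by
    rintro _ ⟨c, rfl⟩ u
    exact ⟨c, by rw [mul_scalarUnitary, ← scalarUnitary_mul, mul_assoc, mul_inv_cancel, mul_one]⟩

/-- The projective unitary group: unitaries modulo scalars. The commutation relation of the
noncommutative torus says that `U` and `V` commute in it. -/
abbrev ProjUnitary (A : Type*) [CStarAlgebra A] : Type _ := unitary A ⧸ (scalarUnitary A).range

/-- The class of a unitary modulo scalars. -/
def projUnitary (A : Type*) [CStarAlgebra A] : unitary A →* ProjUnitary A :=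
  QuotientGroup.mk' (scalarUnitary A).range

theorem projUnitary_eq_iff {u v : unitary A} :
    projUnitary A u = projUnitary A v ↔ ∃ c : Circle, u = scaleUnitary c v := by
  refine eq_comm.trans (QuotientGroup.eq.trans (exists_congr fun c => ?_))
  rw [← mul_scalarUnitary, eq_inv_mul_iff_mul_eq, eq_comm]

theorem projUnitary_scaleUnitary (c : Circle) (u : unitary A) :
    projUnitary A (scaleUnitary c u) = projUnitary A u := projUnitary_eq_iff.2 ⟨c, rfl⟩

theorem projUnitary_mapUnitary_congr (φ : A →⋆ₐ[ℂ] B) {u v : unitary A}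
    (h : projUnitary A u = projUnitary A v) :
    projUnitary B (mapUnitary φ u) = projUnitary B (mapUnitary φ v) := by
  obtain ⟨c, rfl⟩ := projUnitary_eq_iff.1 h
  rw [mapUnitary_scaleUnitary, projUnitary_scaleUnitary]

theorem map_eq_zero_of_projUnitary_eq (f : A →ₗ[ℂ] ℂ) {u v : unitary A}
    (h : projUnitary A u = projUnitary A v) (hv : f v = 0) : f u = 0 := by
  obtain ⟨c, rfl⟩ := projUnitary_eq_iff.1 h
  rw [coe_scaleUnitary, map_smul, hv, smul_zero]

theorem unitaryCalculus_eq_scaleUnitary_zpow (u : unitary A) {z₀ : Circle} {l : ℤ}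
    {f : C(Circle, Circle)} (hf : ∀ z, f z = z₀ * z ^ l) :
    unitaryCalculus u f = scaleUnitary z₀ (u ^ l) := by
  have hfactor : f = (ContinuousMap.id Circle).comp (ContinuousMap.mulLeft z₀) *
      .id Circle ^ (l - 1) := by
    ext z
    simp [hf, mul_assoc, mul_self_zpow]
  rw [hfactor, map_mul, map_zpow, unitaryCalculus_const_mul, unitaryCalculus_id,
    unitaryCalculus_id, ← scalarUnitary_mul, ← scalarUnitary_mul, mul_assoc, mul_self_zpow,
    sub_add_cancel]

end Phases

section VectorFunctional

variable {A H : Type*} [CStarAlgebra A] [NormedAddCommGroup H] [InnerProductSpace ℂ H]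
  [CompleteSpace H]

open scoped CStarAlgebra in
/-- The functional `a ↦ ⟪η, π(a) η⟫` of a vector `η` in a representation `π`. -/
def vectorFunctional (π : A →⋆ₐ[ℂ] (H →L[ℂ] H)) (η : H) : A →L[ℂ] ℂ :=
  innerSL ℂ η ∘L ContinuousLinearMap.apply ℂ H η ∘L ⟨π, map_continuous π⟩

theorem vectorFunctional_apply (π : A →⋆ₐ[ℂ] (H →L[ℂ] H)) (η : H) (a : A) :
    vectorFunctional π η a = ⟪η, π a η⟫_ℂ := rfl

theorem vectorFunctional_mem_stateSpace [PartialOrder A] [StarOrderedRing A]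
    (π : A →⋆ₐ[ℂ] (H →L[ℂ] H)) {η : H} (hη : ‖η‖ = 1) :
    vectorFunctional π η ∈ stateSpace A := by
  refine ⟨fun a ha => ?_, ?_⟩
  · obtain ⟨b, rfl⟩ := CStarAlgebra.nonneg_iff_eq_star_mul_self.1 ha
    rw [vectorFunctional_apply, map_mul, map_star, ContinuousLinearMap.star_eq_adjoint,
      mul_apply_eq_comp, ContinuousLinearMap.adjoint_inner_right,
      inner_self_eq_norm_sq_to_K]
    positivity
  · rw [vectorFunctional_apply, map_one, one_apply_eq_self, inner_self_eq_norm_sq_to_K, hη]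
    simp

end VectorFunctional

section GNS

variable {A : Type*} [CStarAlgebra A] [PartialOrder A] {Φ : A →⋆ₐ[ℂ] A}

theorem IsUniquelyErgodic.isErgodicState {φ : A →L[ℂ] ℂ} (h : IsUniquelyErgodic Φ φ) :
    IsErgodicState Φ φ := by
  rw [IsErgodicState, h, extremePoints_singleton]
  rfl

variable [StarOrderedRing A]

theorem preKoopman_pow_toPreGNS (f : A →ₚ[ℂ] ℂ) (hf : ∀ a, f (Φ a) = f a) (k : ℕ) (a : A) :
    (preKoopman f Φ hf ^ k) (f.toPreGNS a) = f.toPreGNS (Φ^[k] a) := by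
  rw [LinearIsometry.coe_pow]
  exact ((Function.Semiconj.iterate_right (f := f.toPreGNS) (ga := Φ)
    (gb := preKoopman f Φ hf) fun _ => rfl) k a).symm

theorem map_eq_zero_of_map_star_mul_iterate_eq_zero (f : A →ₚ[ℂ] ℂ) (hf : ∀ a, f (Φ a) = f a)
    {a : A} (ha : ∀ k > 0, f (star a * Φ^[k] a) = 0) : f a = 0 := by
  have hfixed : preKoopman f Φ hf (f.toPreGNS 1) = f.toPreGNS 1 :=
    congrArg f.toPreGNS (map_one Φ)
  have horth := inner_eq_zero_of_orthogonal_orbit (v := f.toPreGNS a) _ hfixed fun k hk => by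
    rw [preKoopman_pow_toPreGNS]
    exact ha k hk
  rw [inner_eq_zero_symm] at horth
  simpa [PositiveLinearMap.preGNS_inner_def] using horth

theorem gns_cyclicVector (f : A →ₚ[ℂ] ℂ) (a : A) :
    f.gnsStarAlgHom a (cyclicVector f) = (f.toPreGNS a : f.PreGNS) := by
  refine (f.gnsNonUnitalStarAlgHom_apply_coe (a := a) (b := f.toPreGNS 1)).trans ?_
  simp

theorem denseRange_gns_cyclicVector (f : A →ₚ[ℂ] ℂ) :
    DenseRange fun a => f.gnsStarAlgHom a (cyclicVector f) := by
  simp only [gns_cyclicVector]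
  exact UniformSpace.Completion.denseRange_coe.comp f.toPreGNS.surjective.denseRange
    (UniformSpace.Completion.continuous_coe _)

theorem inner_cyclicVector_gns (f : A →ₚ[ℂ] ℂ) (a : A) :
    ⟪cyclicVector f, f.gnsStarAlgHom a (cyclicVector f)⟫_ℂ = f a := by
  rw [gns_cyclicVector]
  refine (UniformSpace.Completion.inner_coe _ _).trans ?_
  simp [PositiveLinearMap.preGNS_inner_def]

theorem koopman_cyclicVector (f : A →ₚ[ℂ] ℂ) (hf : ∀ a, f (Φ a) = f a) :
    koopman f Φ hf (cyclicVector f) = cyclicVector f := by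
  simpa using koopman_gns f Φ hf 1

theorem inner_koopman (f : A →ₚ[ℂ] ℂ) (hf : ∀ a, f (Φ a) = f a) (x y : f.GNS) :
    ⟪koopman f Φ hf x, koopman f Φ hf y⟫_ℂ = ⟪x, y⟫_ℂ := by
  induction x, y using UniformSpace.Completion.induction_on₂ with
  | hp => apply isClosed_eq <;> fun_prop
  | ih x y =>
    have hcoe (z : f.PreGNS) : koopman f Φ hf z = (preKoopman f Φ hf z : f.PreGNS) :=
      ContinuousLinearMap.completion_apply_coe _ _
    rw [hcoe, hcoe]
    simp only [UniformSpace.Completion.inner_coe, LinearIsometry.inner_map_map]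

theorem koopman_gns_apply (f : A →ₚ[ℂ] ℂ) (hf : ∀ a, f (Φ a) = f a) (a : A) (x : f.GNS) :
    koopman f Φ hf (f.gnsStarAlgHom a x) = f.gnsStarAlgHom (Φ a) (koopman f Φ hf x) := by
  refine (denseRange_gns_cyclicVector f).induction_on x ?_ fun b => ?_
  · exact isClosed_eq (by fun_prop) (by fun_prop)
  · have hmul (c d : A) : f.gnsStarAlgHom c (f.gnsStarAlgHom d (cyclicVector f)) =
        f.gnsStarAlgHom (c * d) (cyclicVector f) := by rw [map_mul]; rfl
    rw [hmul, koopman_gns, koopman_gns, hmul, map_mul]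

theorem vectorFunctional_gns_mem_invariantStates (f : A →ₚ[ℂ] ℂ) (hf : ∀ a, f (Φ a) = f a)
    {η : f.GNS} (hη : ‖η‖ = 1) (hfixed : koopman f Φ hf η = η) :
    vectorFunctional f.gnsStarAlgHom η ∈ invariantStates Φ := by
  refine ⟨vectorFunctional_mem_stateSpace _ hη, fun a => ?_⟩
  calc ⟪η, f.gnsStarAlgHom (Φ a) η⟫_ℂ
      = ⟪koopman f Φ hf η, f.gnsStarAlgHom (Φ a) (koopman f Φ hf η)⟫_ℂ := by rw [hfixed]
    _ = ⟪η, f.gnsStarAlgHom a η⟫_ℂ := by rw [← koopman_gns_apply, inner_koopman]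

theorem IsUniquelyErgodic.inner_gns_of_fixed {φ : A →L[ℂ] ℂ} (h : IsUniquelyErgodic Φ φ)
    (f : A →ₚ[ℂ] ℂ) (hf : ∀ a, f (Φ a) = f a) {ξ : f.GNS} (hξ : koopman f Φ hf ξ = ξ) (a : A) :
    ⟪ξ, f.gnsStarAlgHom a ξ⟫_ℂ = φ a * ⟪ξ, ξ⟫_ℂ := by
  obtain rfl | h0 := eq_or_ne ξ 0
  · simp
  set r : ℂ := (‖ξ‖ : ℂ)⁻¹
  have hstate : vectorFunctional f.gnsStarAlgHom (r • ξ) = φ :=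
    h.subset <| vectorFunctional_gns_mem_invariantStates f hf (norm_smul_inv_norm h0)
      ((map_smul _ _ _).trans (congrArg (r • ·) hξ))
  have hnorm : (‖ξ‖ : ℂ) ≠ 0 := by simpa using h0
  rw [← hstate, vectorFunctional_apply, map_smul, inner_smul_left, inner_smul_right,
    inner_self_eq_norm_sq_to_K]
  simp only [r, map_inv₀, Complex.conj_ofReal, Complex.coe_algebraMap]
  field_simp

theorem IsUniquelyErgodic.inner_gns_cyclicVector_of_fixed {φ : A →L[ℂ] ℂ}
    (h : IsUniquelyErgodic Φ φ) (f : A →ₚ[ℂ] ℂ) (hf : ∀ a, f (Φ a) = f a) {ξ : f.GNS}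
    (hξ : koopman f Φ hf ξ = ξ) (a : A) :
    ⟪ξ, f.gnsStarAlgHom a (cyclicVector f)⟫_ℂ = φ a * ⟪ξ, cyclicVector f⟫_ℂ := by
  let fixed : Submodule ℂ f.GNS := LinearMap.eqLocus (koopman f Φ hf) (1 : f.GNS →ₗ[ℂ] f.GNS)
  let S : f.GNS →ₗ[ℂ] f.GNS := (f.gnsStarAlgHom a - φ a • 1 : f.GNS →L[ℂ] f.GNS)
  have hS (x y : f.GNS) : ⟪y, S x⟫_ℂ = ⟪y, f.gnsStarAlgHom a x⟫_ℂ - φ a * ⟪y, x⟫_ℂ := by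
    simp [S, inner_sub_right, inner_smul_right]
  have hquad : ∀ x ∈ fixed, ⟪S x, x⟫_ℂ = 0 := fun x hx => by
    rw [inner_eq_zero_symm, hS, h.inner_gns_of_fixed f hf hx, sub_self]
  have hpolar := inner_map_eq_zero_of_inner_map_self hquad (koopman_cyclicVector f hf) hξ
  rwa [inner_eq_zero_symm, hS, sub_eq_zero] at hpolar

theorem IsUniquelyErgodic.isErgodic {φ : A →L[ℂ] ℂ} (h : IsUniquelyErgodic Φ φ) :
    IsErgodic Φ φ := by
  have hφ : φ ∈ invariantStates Φ := h.symm.subset rfl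
  let f := toPositive φ hφ.1
  refine ⟨hφ, Set.Subset.antisymm (fun ξ hξ => ?_) ?_⟩
  · refine Submodule.mem_span_singleton.2 ⟨⟪cyclicVector f, ξ⟫_ℂ, ?_⟩
    refine ext_inner_right ℂ fun x => (denseRange_gns_cyclicVector f).induction_on x ?_ fun a => ?_
    · exact isClosed_eq (by fun_prop) (by fun_prop)
    · rw [inner_smul_left, inner_conj_symm, inner_cyclicVector_gns,
        h.inner_gns_cyclicVector_of_fixed f hφ.2 hξ, mul_comm]
      rfl
  · intro ξ hξ
    obtain ⟨c, rfl⟩ := Submodule.mem_span_singleton.1 hξ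
    exact (map_smul _ c _).trans (congrArg (c • ·) (koopman_cyclicVector f hφ.2))

end GNS

end CStarDynamics

namespace NCTorus

open CStarDynamics
open scoped ComplexOrder

variable {α : ℝ}

/-- The Weyl unitary `U ^ m * V ^ n`. Modulo scalars these form a commutative group, and they span
a dense subspace of the noncommutative torus. -/
def weyl (α : ℝ) (m n : ℤ) : unitary (NCTorus α) := U α ^ m * V α ^ n

theorem weyl_zero_zero : weyl α 0 0 = 1 := by simp [weyl]

theorem weyl_zero_right (m : ℤ) : weyl α m 0 = U α ^ m := by simp [weyl]

theorem trace_weyl (m n : ℤ) :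
    trace α (weyl α m n : NCTorus α) = if m = 0 ∧ n = 0 then 1 else 0 := trace_zpow α m n

theorem commute_projUnitary_U_V :
    Commute (projUnitary (NCTorus α) (U α)) (projUnitary (NCTorus α) (V α)) := by
  rw [Commute, SemiconjBy, ← map_mul, ← map_mul, projUnitary_eq_iff]
  refine ⟨Circle.exp (2 * Real.pi * α), Subtype.ext ?_⟩
  rw [coe_scaleUnitary, ← phase_eq]
  exact U_mul_V α

theorem projUnitary_weyl (m n : ℤ) : projUnitary (NCTorus α) (weyl α m n) =
    projUnitary (NCTorus α) (U α) ^ m * projUnitary (NCTorus α) (V α) ^ n := by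
  rw [weyl, map_mul, map_zpow, map_zpow]

/-- The unitary of the noncommutative torus given by a word in the generators. -/
def word (α : ℝ) : FreeGroup Bool →* unitary (NCTorus α) :=
  FreeGroup.lift fun i => bif i then U α else V α

theorem ofPoly_mon (c : ℂ) (g : FreeGroup Bool) :
    ofPoly (Poly.mon α c g) = c • (word α g : NCTorus α) := by
  have hlift : ofPolyHom α = polyLift α (U α) (V α) :=
    polyHom_ext (polyLift_u (U α) (V α)).symm (polyLift_v (U α) (V α)).symm
  exact (DFunLike.congr_fun hlift _).trans (polyLiftAlgHom_mon _ _ c g)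

theorem exists_projUnitary_word_eq (g : FreeGroup Bool) :
    ∃ m n : ℤ, projUnitary (NCTorus α) (word α g) = projUnitary (NCTorus α) (weyl α m n) := by
  let p := projUnitary (NCTorus α)
  let weylHom : Multiplicative ℤ × Multiplicative ℤ →* ProjUnitary (NCTorus α) :=
    MonoidHom.noncommCoprod (zpowersHom _ (p (U α))) (zpowersHom _ (p (V α))) fun m n =>
      commute_projUnitary_U_V.zpow_zpow m.toAdd n.toAdd
  have hweyl (m n : ℤ) : weylHom (.ofAdd m, .ofAdd n) = p (weyl α m n) :=
    (projUnitary_weyl m n).symm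
  have hrange : (word α).range ≤ weylHom.range.comap p := by
    refine FreeGroup.range_lift_le ?_
    rintro _ ⟨_ | _, rfl⟩
    · exact ⟨_, (hweyl 0 1).trans (by simp [weyl])⟩
    · exact ⟨_, (hweyl 1 0).trans (by simp [weyl])⟩
  obtain ⟨⟨m, n⟩, hmn⟩ := hrange ⟨g, rfl⟩
  exact ⟨m, n, hmn.symm.trans (hweyl m n)⟩

theorem dense_span_weyl :
    Dense (Submodule.span ℂ (Set.range fun p : ℤ × ℤ => (weyl α p.1 p.2 : NCTorus α)) :
      Set (NCTorus α)) := by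
  refine Dense.mono ?_ (denseRange_ofPoly (α := α))
  rintro _ ⟨x, rfl⟩
  induction x using Poly.induction with
  | h0 =>
    have hzero : ofPoly (0 : Poly α) = 0 := map_zero (ofPolyHom α)
    exact hzero ▸ Submodule.zero_mem _
  | hadd x y hx hy => exact ofPoly_add x y ▸ Submodule.add_mem _ hx hy
  | hmon c g =>
    obtain ⟨m, n, hmn⟩ := exists_projUnitary_word_eq (α := α) g
    obtain ⟨d, hd⟩ := projUnitary_eq_iff.1 hmn
    rw [ofPoly_mon, hd, coe_scaleUnitary]
    exact Submodule.smul_mem _ _ (Submodule.smul_mem _ _ (Submodule.subset_span ⟨(m, n), rfl⟩))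

theorem eq_trace_of_map_weyl {φ : NCTorus α →L[ℂ] ℂ} (h1 : φ 1 = 1)
    (h : ∀ m n : ℤ, ¬(m = 0 ∧ n = 0) → φ (weyl α m n) = 0) : φ = trace α := by
  refine ContinuousLinearMap.ext_on dense_span_weyl ?_
  rintro _ ⟨⟨m, n⟩, rfl⟩
  change φ (weyl α m n) = trace α (weyl α m n)
  rw [trace_weyl]
  split_ifs with hmn
  · rw [hmn.1, hmn.2, weyl_zero_zero]
    exact h1
  · exact h m n hmn

/-- An endomorphism `Φ` is an affine skew product with rotation number `c` and degree `l` if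
`Φ U = c U` and `Φ V` is a scalar multiple of `U ^ l V`; for `α = 0` it is composition with an
affine map `(z, w) ↦ (c z, d z ^ l w)` of the two-torus. -/
structure IsAffineSkewProduct (Φ : NCTorus α →⋆ₐ[ℂ] NCTorus α) (c : Circle) (l : ℤ) : Prop where
  map_U : mapUnitary Φ (U α) = scaleUnitary c (U α)
  map_V : projUnitary (NCTorus α) (mapUnitary Φ (V α)) = projUnitary (NCTorus α) (U α ^ l * V α)

namespace IsAffineSkewProduct

variable {Φ : NCTorus α →⋆ₐ[ℂ] NCTorus α} {c : Circle} {l : ℤ}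

theorem projUnitary_map_weyl (hΦ : IsAffineSkewProduct Φ c l) (m n : ℤ) :
    projUnitary (NCTorus α) (mapUnitary Φ (weyl α m n)) =
      projUnitary (NCTorus α) (weyl α (m + l * n) n) := by
  have hcomm := (commute_projUnitary_U_V (α := α)).zpow_left l
  rw [weyl, map_mul, map_zpow, map_zpow, map_mul, map_zpow, map_zpow, hΦ.map_U, hΦ.map_V,
    projUnitary_scaleUnitary, map_mul, map_zpow, hcomm.mul_zpow, projUnitary_weyl, zpow_add,
    zpow_mul, mul_assoc]

theorem projUnitary_iterate_map_weyl (hΦ : IsAffineSkewProduct Φ c l) (k : ℕ) (m n : ℤ) :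
    projUnitary (NCTorus α) ((mapUnitary Φ)^[k] (weyl α m n)) =
      projUnitary (NCTorus α) (weyl α (m + k * l * n) n) := by
  induction k with
  | zero => simp
  | succ k ih =>
    rw [Function.iterate_succ_apply', projUnitary_mapUnitary_congr Φ ih, hΦ.projUnitary_map_weyl]
    congr 2
    push_cast
    ring

theorem projUnitary_inv_mul_iterate_map_weyl (hΦ : IsAffineSkewProduct Φ c l) (k : ℕ) (m n : ℤ) :
    projUnitary (NCTorus α) ((weyl α m n)⁻¹ * (mapUnitary Φ)^[k] (weyl α m n)) =
      projUnitary (NCTorus α) (U α ^ (k * l * n)) := by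
  have hcomm := (commute_projUnitary_U_V (α := α)).zpow_zpow (k * l * n) n
  rw [map_mul, map_inv, hΦ.projUnitary_iterate_map_weyl, inv_mul_eq_iff_eq_mul, projUnitary_weyl,
    projUnitary_weyl, map_zpow, zpow_add, mul_assoc (_ ^ m), mul_assoc (_ ^ m), hcomm.eq]

theorem map_U_zpow_eq_zero (hΦ : IsAffineSkewProduct Φ c l) (hc : ¬IsOfFinOrder c)
    {f : NCTorus α →ₗ[ℂ] ℂ} (hf : ∀ a, f (Φ a) = f a) {m : ℤ} (hm : m ≠ 0) :
    f (U α ^ m : unitary (NCTorus α)) = 0 := by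
  have hmap : mapUnitary Φ (U α ^ m) = scaleUnitary (c ^ m) (U α ^ m) := by
    rw [map_zpow, hΦ.map_U, scaleUnitary_zpow]
  have hinv : f (mapUnitary Φ (U α ^ m)) = f (U α ^ m : unitary (NCTorus α)) := hf _
  rw [hmap, coe_scaleUnitary, map_smul, smul_eq_mul, mul_left_eq_self₀] at hinv
  refine hinv.resolve_left fun h => hc ?_
  exact isOfFinOrder_iff_zpow_eq_one.2 ⟨m, hm, Circle.ext h⟩

theorem map_weyl_eq_zero (hΦ : IsAffineSkewProduct Φ c l) (hc : ¬IsOfFinOrder c) (hl : l ≠ 0)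
    (f : NCTorus α →ₚ[ℂ] ℂ) (hf : ∀ a, f (Φ a) = f a) {m n : ℤ} (hmn : ¬(m = 0 ∧ n = 0)) :
    f (weyl α m n) = 0 := by
  obtain rfl | hn := eq_or_ne n 0
  · rw [weyl_zero_right]
    exact hΦ.map_U_zpow_eq_zero hc (f := f.toLinearMap) hf (by simpa using hmn)
  refine map_eq_zero_of_map_star_mul_iterate_eq_zero f hf fun k hk => ?_
  have hiter : ((mapUnitary Φ)^[k] (weyl α m n) : NCTorus α) = Φ^[k] (weyl α m n) :=
    (Function.Semiconj.iterate_right (f := Subtype.val) (fun _ => rfl) k) _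
  rw [← hiter]
  refine map_eq_zero_of_projUnitary_eq f.toLinearMap
    (hΦ.projUnitary_inv_mul_iterate_map_weyl k m n) (hΦ.map_U_zpow_eq_zero hc hf ?_)
  exact mul_ne_zero (mul_ne_zero (by exact_mod_cast hk.ne') hl) hn

theorem trace_map (hΦ : IsAffineSkewProduct Φ c l) (a : NCTorus α) :
    trace α (Φ a) = trace α a := by
  suffices trace α ∘L ⟨Φ, continuous_hom Φ⟩ = trace α from DFunLike.congr_fun this a
  refine eq_trace_of_map_weyl ?_ fun m n hmn => ?_
  · exact (congrArg (trace α) (map_one Φ)).trans (trace_mem_stateSpace α).2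
  · refine map_eq_zero_of_projUnitary_eq (trace α).toLinearMap (hΦ.projUnitary_map_weyl m n) ?_
    refine (trace_weyl _ _).trans (if_neg ?_)
    rintro ⟨hm, rfl⟩
    exact hmn ⟨by simpa using hm, rfl⟩

theorem isUniquelyErgodic_trace (hΦ : IsAffineSkewProduct Φ c l) (hc : ¬IsOfFinOrder c)
    (hl : l ≠ 0) : IsUniquelyErgodic Φ (trace α) := by
  refine Set.Subset.antisymm (fun φ hφ => ?_)
    (Set.singleton_subset_iff.2 ⟨trace_mem_stateSpace α, hΦ.trace_map⟩)
  exact eq_trace_of_map_weyl hφ.1.2 fun m n hmn =>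
    hΦ.map_weyl_eq_zero hc hl (toPositive φ hφ.1) hφ.2 hmn

end IsAffineSkewProduct

theorem isAffineSkewProduct_anzai (α θ : ℝ) (z₀ : Circle) {l : ℤ} {f : C(Circle, Circle)}
    (hf : ∀ z, f z = z₀ * z ^ l) :
    IsAffineSkewProduct (anzai α θ f : NCTorus α →⋆ₐ[ℂ] NCTorus α) (Circle.exp θ) l where
  map_U := Subtype.ext (anzai_U α θ f)
  map_V := by
    refine projUnitary_eq_iff.2 ⟨z₀, Subtype.ext ((anzai_V α θ f).trans ?_)⟩
    rw [unitaryCalculus_eq_scaleUnitary_zpow _ hf, coe_scaleUnitary, coe_scaleUnitary]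
    exact smul_mul_assoc _ _ _

theorem not_isOfFinOrder_exp {θ : ℝ} (hθ : Irrational (θ / (2 * Real.pi))) :
    ¬IsOfFinOrder (Circle.exp θ) := by
  rw [isOfFinOrder_iff_zpow_eq_one]
  rintro ⟨m, hm, h⟩
  rw [← Circle.exp_zsmul, Circle.exp_eq_one] at h
  obtain ⟨n, h⟩ := h
  have hm' : (m : ℝ) ≠ 0 := by exact_mod_cast hm
  refine hθ ⟨n / m, ?_⟩
  rw [zsmul_eq_mul] at h
  push_cast
  rw [div_eq_div_iff hm' Real.two_pi_pos.ne', ← h, mul_comm]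

end NCTorus

end

theorem mainTheorem8_general (α θ : ℝ) (hθ : Irrational (θ / (2 * Real.pi))) (z₀ : Circle)
    {l : ℤ} (hl : l ≠ 0) (f : C(Circle, Circle)) (hf : ∀ z : Circle, f z = z₀ * z ^ l) :
    CStarDynamics.IsErgodic (NCTorus.anzai α θ f : NCTorus α →⋆ₐ[ℂ] NCTorus α)
        (NCTorus.trace α) ∧
      CStarDynamics.IsErgodicState (NCTorus.anzai α θ f : NCTorus α →⋆ₐ[ℂ] NCTorus α)
        (NCTorus.trace α) ∧
      CStarDynamics.IsUniquelyErgodic (NCTorus.anzai α θ f : NCTorus α →⋆ₐ[ℂ] NCTorus α)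
        (NCTorus.trace α) := by
  have h := (NCTorus.isAffineSkewProduct_anzai α θ z₀ hf).isUniquelyErgodic_trace
    (NCTorus.not_isOfFinOrder_exp hθ) hl
  exact ⟨h.isErgodic, h.isErgodicState, h⟩

theorem mainTheorem8 (α θ : ℝ) (hθ : Irrational (θ / (2 * Real.pi))) (z₀ : Circle)
    (f : C(Circle, Circle)) (hf : ∀ z : Circle, f z = z₀ * z) :
    CStarDynamics.IsErgodic (NCTorus.anzai α θ f : NCTorus α →⋆ₐ[ℂ] NCTorus α)
        (NCTorus.trace α) ∧
      CStarDynamics.IsErgodicState (NCTorus.anzai α θ f : NCTorus α →⋆ₐ[ℂ] NCTorus α)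
        (NCTorus.trace α) ∧
      CStarDynamics.IsUniquelyErgodic (NCTorus.anzai α θ f : NCTorus α →⋆ₐ[ℂ] NCTorus α)
        (NCTorus.trace α) := by
  exact mainTheorem8_general α θ hθ z₀ one_ne_zero f (by simpa using hf)
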